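/- Let $0<q<1$, $\alpha>-1$, $t>0$, and let $$w(x)=\frac{x^{\alpha}}{(-(1-q)x;q)_\infty\,(-(1-q)t/x;q)_\infty},\qquad x>0,\qquad (a;q)_\infty:=\prod_{j=0}^{\infty}(1-aq^j).$$ Let $(P_n)_{n\ge 0}$ be the monic polynomials, $\deg P_n=n$, orthogonal with respect to $w$ on $[0,\infty)$, that is $\int_0^\infty P_m(x)P_n(x)w(x)\,dx=0$ for $m\ne n$, and write $P_n(x)=x^n+p(n)x^{n-1}+\cdots$ with $p(0)=0$. Put $$T=\frac{(1-q)^2}{q}\,t,\qquad \varrho_n=\frac{(1-q)^2}{q}\,p(n),\qquad J_n=\frac1T\Bigl(1-q^{-2n-\alpha-1}+\frac{\varrho_n-q\varrho_{n+1}}{1-q}\Bigr)\qquad(n\ge 0),$$ $$F_n=-q^{2n+\alpha}T J_n^2+\bigl[q^{2n+\alpha}(\varrho_n+1)-1\bigr]J_n-q^n,\qquad G_n=q^{2n+\alpha}(T-\varrho_n)J_n^2+q^n(1-q^{n+\alpha})J_n,$$ and, for $n\ge 1$, $$H_n=\frac{J_nJ_{n-1}q^n(1-q^{n+\alpha})}{J_n+J_{n-1}},\qquad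 I_n=q^n+\frac{J_nJ_{n-1}\bigl(1-q^{2n+\alpha}(1+\varrho_n)\bigr)}{J_n+J_{n-1}}.$$ Then for every $n\ge 1$ one has $J_n+J_{n-1}\neq 0$ (so that $H_n$ and $I_n$ are well defined), and $\varrho_n$ satisfies the second-order nonlinear difference equation $$\begin{aligned} &(J_n+J_{n-1})^2G_n^2-(J_n+J_{n-1})\Bigl\{J_nJ_{n-1}q^n(1-q^{n+\alpha})(2G_n-F_n^2)\\ &\qquad-\bigl(q^n(J_n+J_{n-1})+J_nJ_{n-1}[1-q^{2n+\alpha}(1+\varrho_n)]\bigr)F_nG_n\Bigr\}\\ &\quad+\bigl\{q^n(J_n+J_{n-1})+J_nJ_{n-1}[1-q^{2n+\alpha}(1+\varrho_n)]\bigr\}J_nJ_{n-1}q^n(1-q^{n+\alpha})F_n\\ &\quad+\bigl\{q^n(J_n+J_{n-1})+J_nJ_{n-1}[1-q^{2n+\alpha}(1+\varrho_n)]\bigr\}^2G_n +(J_nJ_{n-1})^2q^{2n}(1-q^{n+\alpha})^2=0, \end{aligned}$$ equivalently (dividing by $(J_n+J_{n-1})^2$) $$G_n^2-H_n(2G_n-F_n^2)+I_nF_nG_n+I_nH_nF_n+I_n^2G_n+H_n^2=0.$$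 -/

import Mathlib

open MeasureTheory Polynomial

noncomputable section

namespace QLaguerre

/-- The infinite `q`-shifted factorial `(a; q)_∞ = ∏_{j ≥ 0} (1 - a q^j)`. -/
def qPochhammerInf (a q : ℝ) : ℝ := ∏' j : ℕ, (1 - a * q ^ j)

/-- The deformed `q`-Laguerre weight
`w(x) = x^α / ((-(1-q)x; q)_∞ (-(1-q)t/x; q)_∞)`, used for `x > 0`. -/
def weight (q α t x : ℝ) : ℝ :=
  x ^ α / (qPochhammerInf (-(1 - q) * x) q * qPochhammerInf (-(1 - q) * (t / x)) q)

/-- `P` is the sequence of monic polynomials, `P n` of degree `n`, that are orthogonal with respect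
to the weight `w` on `(0, ∞)`. -/
structure IsMonicOrthogonal (w : ℝ → ℝ) (P : ℕ → ℝ[X]) : Prop where
  monic : ∀ n, (P n).Monic
  natDegree_eq : ∀ n, (P n).natDegree = n
  orthogonal : ∀ m n, m ≠ n →
    ∫ x in Set.Ioi (0 : ℝ), (P m).eval x * (P n).eval x * w x = 0

/-- The subleading coefficient `p(n)` in `P n = x ^ n + p(n) x ^ (n - 1) + ⋯`, with `p(0) = 0`. -/
def subleading (P : ℕ → ℝ[X]) (n : ℕ) : ℝ := (P n).nextCoeff

/-- `T = (1 - q)² t / q`. -/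
def paramT (q t : ℝ) : ℝ := (1 - q) ^ 2 / q * t

/-- `ϱ_n = (1 - q)² p(n) / q`. -/
def rho (q : ℝ) (P : ℕ → ℝ[X]) (n : ℕ) : ℝ := (1 - q) ^ 2 / q * subleading P n

/-! In what follows `T` is a number and `ϱ` a sequence of numbers. -/

/-- `J_n = (1 - q^(-2n-α-1) + (ϱ_n - q ϱ_{n+1}) / (1 - q)) / T`. -/
def J (q α T : ℝ) (ϱ : ℕ → ℝ) (n : ℕ) : ℝ :=
  1 / T * (1 - q ^ (-2 * (n : ℝ) - α - 1) + (ϱ n - q * ϱ (n + 1)) / (1 - q))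

/-- `F_n = -q^(2n+α) T J_n² + [q^(2n+α) (ϱ_n + 1) - 1] J_n - q^n`. -/
def F (q α T : ℝ) (ϱ : ℕ → ℝ) (n : ℕ) : ℝ :=
  -q ^ (2 * (n : ℝ) + α) * T * J q α T ϱ n ^ 2
    + (q ^ (2 * (n : ℝ) + α) * (ϱ n + 1) - 1) * J q α T ϱ n - q ^ n

/-- `G_n = q^(2n+α) (T - ϱ_n) J_n² + q^n (1 - q^(n+α)) J_n`. -/
def G (q α T : ℝ) (ϱ : ℕ → ℝ) (n : ℕ) : ℝ :=
  q ^ (2 * (n : ℝ) + α) * (T - ϱ n) * J q α T ϱ n ^ 2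
    + q ^ n * (1 - q ^ ((n : ℝ) + α)) * J q α T ϱ n

/-- `H_n = J_n J_{n-1} q^n (1 - q^(n+α)) / (J_n + J_{n-1})`, used for `n ≥ 1`. -/
def H (q α T : ℝ) (ϱ : ℕ → ℝ) (n : ℕ) : ℝ :=
  J q α T ϱ n * J q α T ϱ (n - 1) * q ^ n * (1 - q ^ ((n : ℝ) + α))
    / (J q α T ϱ n + J q α T ϱ (n - 1))

/-- `I_n = q^n + J_n J_{n-1} (1 - q^(2n+α) (1 + ϱ_n)) / (J_n + J_{n-1})`, used for `n ≥ 1`. -/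
def I (q α T : ℝ) (ϱ : ℕ → ℝ) (n : ℕ) : ℝ :=
  q ^ n + J q α T ϱ n * J q α T ϱ (n - 1) * (1 - q ^ (2 * (n : ℝ) + α) * (1 + ϱ n))
    / (J q α T ϱ n + J q α T ϱ (n - 1))

/-- The left-hand side of the second-order difference equation for `ϱ`, cleared of the denominator
`J_n + J_{n-1}`; a polynomial in `J_n`, `J_{n-1}`, `F_n`, `G_n` and `ϱ_n`, used for `n ≥ 1`. -/
def differencePolynomial (q α T : ℝ) (ϱ : ℕ → ℝ) (n : ℕ) : ℝ :=
  let Jn := J q α T ϱ n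
  let Jm := J q α T ϱ (n - 1)
  let Fn := F q α T ϱ n
  let Gn := G q α T ϱ n
  (Jn + Jm) ^ 2 * Gn ^ 2
    - (Jn + Jm) *
      (Jn * Jm * q ^ n * (1 - q ^ ((n : ℝ) + α)) * (2 * Gn - Fn ^ 2)
        - (q ^ n * (Jn + Jm) + Jn * Jm * (1 - q ^ (2 * (n : ℝ) + α) * (1 + ϱ n))) * Fn * Gn)
    + (q ^ n * (Jn + Jm) + Jn * Jm * (1 - q ^ (2 * (n : ℝ) + α) * (1 + ϱ n)))
      * (Jn * Jm * q ^ n * (1 - q ^ ((n : ℝ) + α))) * Fn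
    + (q ^ n * (Jn + Jm) + Jn * Jm * (1 - q ^ (2 * (n : ℝ) + α) * (1 + ϱ n))) ^ 2 * Gn
    + (Jn * Jm) ^ 2 * q ^ (2 * n) * (1 - q ^ ((n : ℝ) + α)) ^ 2

end QLaguerre

end

/-!
Let `M f = ∫ f(x) w(x) / x dx` over `x > 0`, let `h n` be the squared norm of `P n` for the weight
`w`, and put

* `β n = h n / h (n - 1)`,
* `S n = M (P n ^ 2) / h n`,
* `R n = M (P n * P (n - 1)) / h (n - 1)`.

The weight satisfies the Pearson equation
`(q x + (1 - q) t) w(q x) = q ^ (α + 1) x (1 + (1 - q) x) w(x)` (`weight_mul`), which turns into a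
relation between `M (f(x / q) g(x))` and `M (f(x) g(q x))`. Applied to `f = g = P n` it identifies
`S n` with `(1 - q) q ^ (n + α) J n` (`J_eq_diagRatio`). As `M (P n ^ 2) > 0`, this gives `J n > 0`,
and so `J n + J (n - 1) ≠ 0`. Applied to `f = P n`, `g = P (n - 1)` it expresses `β n` linearly
through `R n` and `p n`.

Two more relations hold for any weight: `R (n + 1) + R n + (p n - p (n + 1)) S n = 1`, from the
three-term recurrence, and `β n * S n * S (n - 1) = R n * (R n - 1)`, because `M (P n * P (n - 1))`
equals `P n (0) * M (P (n - 1)) + h (n - 1)` as well as `P (n - 1) (0) * M (P n)`.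

These four relations (`LadderRelations`) define a recursion that has a first integral, whose value
is fixed at `n = 0`: by induction on `n` one gets a relation linear in `S n` and `S (n - 1)`
(`LadderRelations.quadratic_offdiag`), and, on multiplying by `S n`, one without `S (n - 1)`
(`LadderRelations.quadratic_diag`). In terms of `x = q ^ n (1 - R n)` they become `x² - I x + H = 0`
and `x² + F x + G = 0`. The difference equation is the vanishing of the resultant of these two
quadratic polynomials.
-/

namespace QLaguerre

/-! ### Common root and first integral -/

/-- The left-hand side is the resultant of `X² + F X + G` and `X² - I X + H`. -/
theorem resultant_eq_zero_of_common_root {F G H I x : ℝ} (h₁ : x ^ 2 + F * x + G = 0)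
    (h₂ : x ^ 2 - I * x + H = 0) :
    G ^ 2 - H * (2 * G - F ^ 2) + I * F * G + I * H * F + I ^ 2 * G + H ^ 2 = 0 := by
  linear_combination (F + I) ^ 2 * h₁ +
    ((G - H) - (F + I) * x - F * (F + I)) * (h₁ - h₂)

/-- The algebraic relations tying the subleading coefficients `p n` to the norm ratios
`β n = h n / h (n - 1)` and to `S n = M (P n ^ 2) / h n`, `R n = M (P n * P (n - 1)) / h (n - 1)`,
where `M f = ∫ f(x) w(x) / x dx` and `h n = M (X * P n ^ 2)`. At `n = 0`, where `P (-1)` does not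
exist, `R` is set to `0`, and `offdiag` then forces `β 0 = 0`. The relations
`diag` and `offdiag` come from the Pearson equation of the weight; `sum` and `prod` hold for
orthogonal polynomials of any weight on the half-line. -/
structure LadderRelations (q b t : ℝ) (p β R S : ℕ → ℝ) : Prop where
  p_zero : p 0 = 0
  R_zero : R 0 = 0
  S_pos : ∀ n, 0 < S n
  diag : ∀ n, q ^ n * ((1 - q) * t) * S n =
    -1 + (q ^ n) ^ 2 * b * (q + (1 - q) * (p n - q * p (n + 1)))
  offdiag : ∀ n, b * (q ^ n) ^ 2 * β n = -p n + t * (q ^ n * (R n - 1) + 1)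
  sum : ∀ n, R (n + 1) + R n + (p n - p (n + 1)) * S n = 1
  prod : ∀ n, β (n + 1) * S (n + 1) * S n = R (n + 1) * (R (n + 1) - 1)

namespace LadderRelations

variable {q b t : ℝ} {p β R S : ℕ → ℝ}

/-- One half of the induction: modulo the ladder relations, the quadratic relation at `n` is `S n`
times a relation at `n + 1` that is linear in `S n` and `S (n + 1)`, and `S n > 0` cancels. -/
theorem quadratic_step (h : LadderRelations q b t p β R S) (n : ℕ)
    (hn : (1 - q) * (q ^ n) ^ 2 * b * (β n * S n ^ 2 + q * (R n * (R n - 1))) =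
      S n * (q * (q ^ n * b - R n)
        - (1 - R n) * (q ^ n) ^ 2 * b * (q + (1 - q) ^ 2 * p n))) :
    (1 - q) * (q ^ (n + 1)) ^ 2 * b * (β (n + 1) * (S (n + 1) + q * S n)) =
      q * (q ^ (n + 1) * b - R (n + 1))
        - (1 - R (n + 1)) * (q ^ (n + 1)) ^ 2 * b * (q + (1 - q) ^ 2 * p (n + 1)) := by
  have h1 := h.diag n
  have h2 := h.sum n
  have h3 := h.offdiag n
  have h3' := h.offdiag (n + 1)
  have h4 := h.prod n
  apply mul_right_cancel₀ (h.S_pos n).ne'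
  -- Eliminating `R (n + 1)` leaves an identity that is linear in the other relations.
  have hR : R (n + 1) = 1 - R n - (p n - p (n + 1)) * S n := by linarith
  rw [hR] at h3' h4 ⊢
  rw [pow_succ] at *
  linear_combination q * hn + (1 - q) * (q ^ n * q) ^ 2 * b * h4
   + (1 - q) * q * S n ^ 2 * h3' - (1 - q) * q * S n ^ 2 * h3
   + q * S n * (q * (1 - R n - (p n - p (n + 1)) * S n - 1) - R n + 1) * h1

/-- A first integral of the ladder relations, in which neither `S (n - 1)` nor `S (n + 1)` occurs.
At `n = 0` it holds because `p 0` and `R 0` vanish. -/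
theorem quadratic_diag (h : LadderRelations q b t p β R S) (n : ℕ) :
    (1 - q) * (q ^ n) ^ 2 * b * (β n * S n ^ 2 + q * (R n * (R n - 1))) =
      S n * (q * (q ^ n * b - R n)
        - (1 - R n) * (q ^ n) ^ 2 * b * (q + (1 - q) ^ 2 * p n)) := by
  induction n with
  | zero =>
    have h3 := h.offdiag 0
    rw [h.p_zero, h.R_zero] at *
    linear_combination (1 - q) * S 0 ^ 2 * h3
  | succ n ih =>
    have hC := h.quadratic_step n ih
    linear_combination S (n + 1) * hC - (1 - q) * (q ^ (n + 1)) ^ 2 * b * q * h.prod n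

/-- The first integral in the form that involves both `S n` and `S (n + 1)`. -/
theorem quadratic_offdiag (h : LadderRelations q b t p β R S) (n : ℕ) :
    (1 - q) * (q ^ (n + 1)) ^ 2 * b * (β (n + 1) * (S (n + 1) + q * S n)) =
      q * (q ^ (n + 1) * b - R (n + 1))
        - (1 - R (n + 1)) * (q ^ (n + 1)) ^ 2 * b * (q + (1 - q) ^ 2 * p (n + 1)) :=
  h.quadratic_step n (h.quadratic_diag n)

/-- The two first integrals say that `Q (1 - R (n + 1))` is a common root of `X² + F X + G` and
`X² - I X + H`, so that the resultant of the two vanishes. -/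
theorem difference_equation (h : LadderRelations q b t p β R S) (hq0 : 0 < q) (hq1 : q < 1)
    (hb : 0 < b) (n : ℕ) {Q J J' T r F G H I : ℝ} (hQ : Q = q ^ (n + 1))
    (hJ : J = S (n + 1) / (q ^ (n + 1) * b * (1 - q)))
    (hJ' : J' = S n / (q ^ n * b * (1 - q)))
    (hT : T = (1 - q) ^ 2 / q * t) (hr : r = (1 - q) ^ 2 / q * p (n + 1))
    (hF : F = -(Q ^ 2 * b) * T * J ^ 2 + (Q ^ 2 * b * (r + 1) - 1) * J - Q)
    (hG : G = Q ^ 2 * b * (T - r) * J ^ 2 + Q * (1 - Q * b) * J)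
    (hH : H = J * J' * Q * (1 - Q * b) / (J + J'))
    (hI : I = Q + J * J' * (1 - Q ^ 2 * b * (1 + r)) / (J + J')) :
    J + J' ≠ 0 ∧
    G ^ 2 - H * (2 * G - F ^ 2) + I * F * G + I * H * F + I ^ 2 * G + H ^ 2 = 0 := by
  have hS := h.S_pos (n + 1)
  have hS' := h.S_pos n
  have hq : 0 < 1 - q := by linarith
  have hqn : 0 < q ^ n := by positivity
  have hJp : 0 < J := by rw [hJ]; positivity
  have hJp' : 0 < J' := by rw [hJ']; positivity
  have hne : J + J' ≠ 0 := by positivity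
  have hQ0 : 0 < Q := by rw [hQ]; positivity
  refine ⟨hne, ?_⟩
  have hD := h.quadratic_diag (n + 1)
  have hC := h.quadratic_offdiag n
  have h3 := h.offdiag (n + 1)
  have h4 := h.prod n
  have hSJ : S (n + 1) = Q * b * (1 - q) * J := by rw [hJ, hQ]; field_simp
  have hSJ' : q * S n = Q * b * (1 - q) * J' := by rw [hJ', hQ, pow_succ]; field_simp
  have hqT : q * T = (1 - q) ^ 2 * t := by rw [hT]; field_simp
  have hqr : q * r = (1 - q) ^ 2 * p (n + 1) := by rw [hr]; field_simp
  rw [← hQ] at *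
  rw [hSJ] at hD hC h4
  rw [hSJ'] at hC
  generalize p (n + 1) = p₁ at *
  generalize R (n + 1) = R₁ at *
  generalize β (n + 1) = β₁ at *
  apply resultant_eq_zero_of_common_root (x := Q * (1 - R₁))
  · have : q * (1 - q) * b * ((Q * (1 - R₁)) ^ 2 + F * (Q * (1 - R₁)) + G) = 0 := by
      rw [hF, hG]
      linear_combination hD - (1 - q) ^ 3 * b ^ 2 * Q ^ 2 * J ^ 2 * h3
        + (1 - q) * b ^ 2 * Q ^ 2 * J ^ 2 * (1 - Q * (1 - R₁)) * hqT
        + ((1 - q) * b ^ 2 * Q ^ 2 * J * (Q * (1 - R₁)) - (1 - q) * b ^ 2 * Q ^ 2 * J ^ 2) * hqr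
    simpa [hq0.ne', hq.ne', hb.ne'] using this
  · have h5 : q * ((Q * (1 - R₁)) ^ 2 - Q * (Q * (1 - R₁))) * (J + J') =
        q * (J * J' * (Q * (1 - R₁) * (1 - Q ^ 2 * b * (1 + r)) - Q * (1 - Q * b))) := by
      linear_combination Q * J * J' * hC - q * Q ^ 2 * (J + J') * h4
        + β₁ * Q ^ 3 * b * (1 - q) * J * (J + J') * hSJ'
        + J * J' * Q ^ 3 * b * (1 - R₁) * hqr
    have h6 := mul_left_cancel₀ hq0.ne' ((mul_assoc q _ _).symm.trans h5)
    rw [hH, hI]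
    field_simp
    linear_combination h6

end LadderRelations

/-! ### Orthogonal polynomials of a functional -/

/-- The properties of `M f = ∫ f(x) w(x) / x dx` that the argument uses, with `b = q ^ α`. The
orthogonality functional is `f ↦ M (X * f)`; the division by `x` built into `M` keeps all
arguments polynomial. The Pearson relation is stated for products `f(x / q) g(x)`, the form in
which it is applied. -/
structure IsQLaguerreFunctional (q b t : ℝ) (M : ℝ[X] →ₗ[ℝ] ℝ) : Prop where
  pos : ∀ f : ℝ[X], f ≠ 0 → 0 < M (f * f)
  pos_X : ∀ f : ℝ[X], f ≠ 0 → 0 < M (X * (f * f))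
  pearson : ∀ f g : ℝ[X], M ((X + C ((1 - q) * t)) * (f.comp (C q⁻¹ * X) * g)) =
    q * b * M (X * (1 + C (1 - q) * X) * (f * g.comp (C q * X)))

/-- `P` is the monic orthogonal sequence of the functional `f ↦ M (X * f)`. -/
structure IsMonicOrthogonalFor (M : ℝ[X] →ₗ[ℝ] ℝ) (P : ℕ → ℝ[X]) : Prop where
  monic : ∀ n, (P n).Monic
  natDegree_eq : ∀ n, (P n).natDegree = n
  orthogonal : ∀ m n, m ≠ n → M (X * (P m * P n)) = 0

namespace IsMonicOrthogonalFor

variable {M : ℝ[X] →ₗ[ℝ] ℝ} {P : ℕ → ℝ[X]}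

theorem coeff_self (h : IsMonicOrthogonalFor M P) (n : ℕ) : (P n).coeff n = 1 := by
  have := (h.monic n).coeff_natDegree
  rwa [h.natDegree_eq] at this

theorem coeff_of_lt (h : IsMonicOrthogonalFor M P) {n k : ℕ} (hk : n < k) : (P n).coeff k = 0 :=
  coeff_eq_zero_of_natDegree_lt (by rwa [h.natDegree_eq])

theorem coeff_succ (h : IsMonicOrthogonalFor M P) (n : ℕ) :
    (P (n + 1)).coeff n = subleading P (n + 1) := by
  simp [subleading, nextCoeff, h.natDegree_eq]

theorem subleading_zero (h : IsMonicOrthogonalFor M P) : subleading P 0 = 0 := by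
  simp [subleading, nextCoeff, h.natDegree_eq]

theorem map_eq_zero_of_degree_lt (h : IsMonicOrthogonalFor M P) {n : ℕ} {f : ℝ[X]}
    (hf : f.degree < n) : M (X * (P n * f)) = 0 := by
  suffices H : ∀ k ≤ n, ∀ f : ℝ[X], f.degree < k → M (X * (P n * f)) = 0 from H n le_rfl f hf
  intro k
  induction k with
  | zero =>
    intro _ f hf
    have : f = 0 := by
      rw [← degree_eq_bot]; simpa using hf
    simp [this]
  | succ k ih =>
    intro hk f hf
    have h1 := ih (by omega) (f - C (f.coeff k) * P k) (by
      rw [degree_lt_iff_coeff_zero] at hf ⊢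
      intro m hm
      rcases hm.eq_or_lt with rfl | hm
      · simp [h.coeff_self]
      · simp [h.coeff_of_lt hm, hf m hm])
    have h2 : X * (P n * f) =
        X * (P n * (f - C (f.coeff k) * P k)) + f.coeff k • (X * (P n * P k)) := by
      rw [smul_eq_C_mul]; ring
    rw [h2, map_add, h1, map_smul, h.orthogonal n k (by omega)]
    simp

/-- Pairing `P n` with a polynomial of degree at most `n + 1`: expand it in `P (n + 1)`, `P n` and
lower terms. -/
theorem map_X_mul (h : IsMonicOrthogonalFor M P) {n : ℕ} {f : ℝ[X]}
    (hf : f.degree < (n + 2 : ℕ)) :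
    M (X * (P n * f)) =
      (f.coeff n - f.coeff (n + 1) * subleading P (n + 1)) * M (X * (P n * P n)) := by
  set c := f.coeff n - f.coeff (n + 1) * subleading P (n + 1) with hc
  have h1 := h.map_eq_zero_of_degree_lt (n := n)
    (f := f - C (f.coeff (n + 1)) * P (n + 1) - C c * P n) (by
      rw [degree_lt_iff_coeff_zero] at hf ⊢
      intro m hm
      rcases hm.eq_or_lt with rfl | hm
      · simp [h.coeff_self, h.coeff_succ, hc, -_root_.map_sub, -_root_.map_mul]
      rcases (show n + 1 ≤ m from hm).eq_or_lt with rfl | hm'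
      · simp [h.coeff_self, h.coeff_of_lt hm]
      · simp [h.coeff_of_lt hm, h.coeff_of_lt hm', hf m hm'])
  have h2 : X * (P n * f) = X * (P n * (f - C (f.coeff (n + 1)) * P (n + 1) - C c * P n))
      + f.coeff (n + 1) • (X * (P n * P (n + 1))) + c • (X * (P n * P n)) := by
    rw [smul_eq_C_mul, smul_eq_C_mul]; ring
  rw [h2, map_add, map_add, h1, map_smul, map_smul, h.orthogonal n (n + 1) (by omega)]
  simp

/-- Split `f` as `X * f.divX + C (f.coeff 0)` and apply orthogonality to the first summand. -/
theorem map_mul (h : IsMonicOrthogonalFor M P) {n : ℕ} {f : ℝ[X]}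
    (hf : f.degree < (n + 2 : ℕ)) :
    M (P n * f) = f.coeff 0 * M (P n) + f.coeff (n + 1) * M (X * (P n * P n)) := by
  have hd : f.divX.degree < (n + 1 : ℕ) := by
    rw [degree_lt_iff_coeff_zero] at hf ⊢
    intro m hm
    rw [coeff_divX]
    exact hf _ (by omega)
  have h1 := h.map_X_mul (n := n) (f := f.divX) (hd.trans (by exact_mod_cast Nat.lt_succ_self _))
  rw [coeff_divX, coeff_eq_zero_of_degree_lt hd] at h1
  have h2 : P n * f = X * (P n * f.divX) + f.coeff 0 • P n := by
    conv_lhs => rw [← divX_mul_X_add f]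
    rw [smul_eq_C_mul]; ring
  rw [h2, map_add, h1, map_smul, smul_eq_mul]
  ring

theorem degree_lt (h : IsMonicOrthogonalFor M P) {n k : ℕ} (hk : n < k) : (P n).degree < k := by
  rw [degree_lt_iff_coeff_zero]
  exact fun m hm => h.coeff_of_lt (hk.trans_le hm)

theorem map_self (h : IsMonicOrthogonalFor M P) (n : ℕ) :
    M (P n * P n) = (P n).coeff 0 * M (P n) := by
  rw [h.map_mul (h.degree_lt (by omega)), h.coeff_of_lt (Nat.lt_succ_self _)]; ring

/-- Together with `map_mul_succ` this evaluates `M (P (n + 1) * P n)` in two ways, which yields the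
product relation `LadderRelations.prod`. -/
theorem map_succ_mul (h : IsMonicOrthogonalFor M P) (n : ℕ) :
    M (P (n + 1) * P n) = (P n).coeff 0 * M (P (n + 1)) := by
  rw [h.map_mul (n := n + 1) (h.degree_lt (by omega)), h.coeff_of_lt (k := n + 1 + 1) (by omega)]
  ring

theorem map_mul_succ (h : IsMonicOrthogonalFor M P) (n : ℕ) :
    M (P n * P (n + 1)) = (P (n + 1)).coeff 0 * M (P n) + M (X * (P n * P n)) := by
  rw [h.map_mul (h.degree_lt (by omega)), h.coeff_self]; ring

theorem eq_zero_of_orthogonal (h : IsMonicOrthogonalFor M P)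
    (hM : ∀ f, f ≠ 0 → 0 < M (X * (f * f))) {n : ℕ} {f : ℝ[X]} (hf : f.degree < n)
    (hfP : ∀ k < n, M (X * (P k * f)) = 0) : f = 0 := by
  by_contra hf0
  have hk : f.natDegree < n := (natDegree_lt_iff_degree_lt hf0).2 hf
  have h1 := hfP _ hk
  rw [h.map_X_mul (by
      rw [degree_lt_iff_coeff_zero]
      exact fun m hm => coeff_eq_zero_of_natDegree_lt (by omega)),
    coeff_eq_zero_of_natDegree_lt (Nat.lt_succ_self _), zero_mul, sub_zero] at h1
  rcases mul_eq_zero.1 h1 with h1 | h1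
  · exact hf0 (leadingCoeff_eq_zero.1 h1)
  · exact (hM _ (h.monic _).ne_zero).ne' h1

/-- The three-term recurrence, with its coefficients read off from `subleading` and the norms. -/
theorem three_term (h : IsMonicOrthogonalFor M P) (hM : ∀ f, f ≠ 0 → 0 < M (X * (f * f)))
    (n : ℕ) :
    X * P (n + 1) = P (n + 2) + C (subleading P (n + 1) - subleading P (n + 2)) * P (n + 1)
      + C (M (X * (P (n + 1) * P (n + 1))) / M (X * (P n * P n))) * P n := by
  have hn : M (X * (P n * P n)) ≠ 0 := (hM _ (h.monic n).ne_zero).ne'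
  set c := subleading P (n + 1) - subleading P (n + 2)
  set β := M (X * (P (n + 1) * P (n + 1))) / M (X * (P n * P n)) with hβ
  rw [← sub_eq_zero]
  set f := X * P (n + 1) - (P (n + 2) + C c * P (n + 1) + C β * P n) with hf
  have hdeg : f.degree < (n + 1 : ℕ) := by
    rw [degree_lt_iff_coeff_zero]
    intro m hm
    obtain ⟨m, rfl⟩ : ∃ k, m = k + 1 := ⟨m - 1, by omega⟩
    rcases (show n ≤ m by omega).eq_or_lt with rfl | hm
    · simp [hf, coeff_X_mul, h.coeff_self, h.coeff_succ, h.coeff_of_lt, c, -_root_.map_sub]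
    rcases (show n + 1 ≤ m by omega).eq_or_lt with rfl | hm'
    · have := h.coeff_of_lt (n := n) (k := n + 1 + 1) (by omega)
      have this' := h.coeff_of_lt (n := n + 1) (k := n + 1 + 1) (by omega)
      simp [hf, coeff_X_mul, h.coeff_self, this, this']
    · simp [hf, coeff_X_mul, h.coeff_of_lt hm', h.coeff_of_lt (show n + 1 < m + 1 by omega),
        h.coeff_of_lt (show n + 2 < m + 1 by omega), h.coeff_of_lt (show n < m + 1 by omega)]
  -- The remainder has degree at most `n`, so orthogonality to `P 0, …, P n` makes it vanish.
  have key : ∀ k, k ≤ n → M (X * (P k * f)) = 0 := by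
    intro k hk
    have e : X * (P k * f) = X * (P (n + 1) * (X * P k)) - X * (P k * P (n + 2))
        - c • (X * (P k * P (n + 1))) - β • (X * (P k * P n)) := by
      rw [smul_eq_C_mul, smul_eq_C_mul, hf]; ring
    rw [e, map_sub, map_sub, map_sub, map_smul, map_smul, h.orthogonal k (n + 2) (by omega),
      h.orthogonal k (n + 1) (by omega)]
    rw [h.map_X_mul (n := n + 1) (by
      rw [degree_lt_iff_coeff_zero]
      intro m hm
      obtain ⟨m, rfl⟩ : ∃ k, m = k + 1 := ⟨m - 1, by omega⟩
      rw [coeff_X_mul, h.coeff_of_lt (by omega)])]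
    rw [coeff_X_mul, coeff_X_mul, h.coeff_of_lt (show k < n + 1 by omega)]
    rcases hk.eq_or_lt with rfl | hk
    · rw [h.coeff_self, hβ]; simp; field_simp; simp
    · rw [h.coeff_of_lt hk, h.orthogonal k n (by omega)]; simp
  exact h.eq_zero_of_orthogonal hM hdeg fun k hk => key k (by omega)

/-- The recurrence at `n = 0`, where the term with `P (n - 1)` is absent. -/
theorem three_term_zero (h : IsMonicOrthogonalFor M P)
    (hM : ∀ f, f ≠ 0 → 0 < M (X * (f * f))) :
    X * P 0 = P 1 + C (subleading P 0 - subleading P 1) * P 0 := by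
  rw [← sub_eq_zero]
  refine h.eq_zero_of_orthogonal hM (n := 0) ?_ (by simp)
  rw [degree_lt_iff_coeff_zero]
  intro m _
  have h1 := h.coeff_succ 0
  have h0 := h.coeff_self 0
  have h1' := h.coeff_self 1
  rcases m with _ | _ | m
  · simp [h.subleading_zero, h0, h1]
  · simp [h.coeff_of_lt (show 0 < 1 by omega), coeff_X_mul, h0, h1', -_root_.map_sub]
  · simp [h.coeff_of_lt (show 1 < m + 1 + 1 by omega), h.coeff_of_lt (show 0 < m + 1 + 1 by omega),
      h.coeff_of_lt (show 0 < m + 1 by omega), coeff_X_mul, -_root_.map_sub]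

theorem coeff_X_mul_comp (h : IsMonicOrthogonalFor M P) {q : ℝ} (hq : q ≠ 0) (n : ℕ) :
    (X * (P n).comp (C q * X)).coeff n = q ^ n / q * subleading P n := by
  rcases n with _ | n
  · simp [h.subleading_zero]
  · rw [coeff_X_mul, comp_C_mul_X_coeff, h.coeff_succ]
    field_simp
    ring

theorem degree_X_mul_comp (h : IsMonicOrthogonalFor M P) (q : ℝ) (n : ℕ) :
    (X * (P n).comp (C q * X) : ℝ[X]).degree < (n + 2 : ℕ) := by
  rw [degree_lt_iff_coeff_zero]
  intro m hm
  obtain ⟨m, rfl⟩ : ∃ k, m = k + 1 := ⟨m - 1, by omega⟩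
  rw [coeff_X_mul, comp_C_mul_X_coeff, h.coeff_of_lt (by omega), zero_mul]

theorem degree_comp_lt (h : IsMonicOrthogonalFor M P) (r : ℝ) {n k : ℕ} (hk : n < k) :
    ((P n).comp (C r * X)).degree < k := by
  rw [degree_lt_iff_coeff_zero]
  intro m hm
  rw [comp_C_mul_X_coeff, h.coeff_of_lt (by omega), zero_mul]

end IsMonicOrthogonalFor

/-- `S n = ∫ P_n² w / x` divided by the squared norm of `P n`. -/
noncomputable def diagRatio (M : ℝ[X] →ₗ[ℝ] ℝ) (P : ℕ → ℝ[X]) (n : ℕ) : ℝ :=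
  M (P n * P n) / M (X * (P n * P n))

/-- `R n = ∫ P_n P_{n-1} w / x` divided by the squared norm of `P (n - 1)`, with `R 0 = 0`. -/
noncomputable def offdiagRatio (M : ℝ[X] →ₗ[ℝ] ℝ) (P : ℕ → ℝ[X]) : ℕ → ℝ
  | 0 => 0
  | n + 1 => M (P (n + 1) * P n) / M (X * (P n * P n))

/-- The ratio `β n` of the squared norms of `P n` and `P (n - 1)`, with `β 0 = 0`. -/
noncomputable def normRatio (M : ℝ[X] →ₗ[ℝ] ℝ) (P : ℕ → ℝ[X]) : ℕ → ℝ
  | 0 => 0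
  | n + 1 => M (X * (P (n + 1) * P (n + 1))) / M (X * (P n * P n))

namespace IsQLaguerreFunctional

variable {q b t : ℝ} {M : ℝ[X] →ₗ[ℝ] ℝ} {P : ℕ → ℝ[X]}

/-- The Pearson relation, expanded into pairings with the orthogonality functional and with `M`. -/
theorem pearson_expand (hM : IsQLaguerreFunctional q b t M) (f g : ℝ[X]) :
    M (X * (g * f.comp (C q⁻¹ * X))) + (1 - q) * t * M (g * f.comp (C q⁻¹ * X)) =
      q * b * (M (X * (f * g.comp (C q * X))) +
        (1 - q) * M (X * (f * (X * g.comp (C q * X))))) := by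
  have h := hM.pearson f g
  have e1 : (X + C ((1 - q) * t)) * (f.comp (C q⁻¹ * X) * g) =
      X * (g * f.comp (C q⁻¹ * X)) + ((1 - q) * t) • (g * f.comp (C q⁻¹ * X)) := by
    rw [smul_eq_C_mul]; ring
  have e2 : X * (1 + C (1 - q) * X) * (f * g.comp (C q * X)) =
      X * (f * g.comp (C q * X)) + (1 - q) • (X * (f * (X * g.comp (C q * X)))) := by
    rw [smul_eq_C_mul]; ring
  rwa [e1, e2, map_add, map_add, map_smul, map_smul, smul_eq_mul, smul_eq_mul] at h

/-- The first two relations are the Pearson relation for the pairs `(P n, P n)` and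
`(P (n + 1), P n)`; the last two follow from the three-term recurrence and from the two
evaluations of `M (P (n + 1) * P n)`. -/
theorem ladderRelations (hM : IsQLaguerreFunctional q b t M) (h : IsMonicOrthogonalFor M P)
    (hq0 : 0 < q) (hq1 : q < 1) :
    LadderRelations q b t (subleading P) (normRatio M P) (offdiagRatio M P) (diagRatio M P) := by
  have hpos : ∀ n, 0 < M (X * (P n * P n)) := fun n => hM.pos_X _ (h.monic n).ne_zero
  have hq : 0 < 1 - q := by linarith
  refine ⟨h.subleading_zero, rfl, fun n => div_pos (hM.pos _ (h.monic n).ne_zero) (hpos n),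
    fun n => ?_, fun n => ?_, fun n => ?_, fun n => ?_⟩
  · have h0 := (hpos n).ne'
    have e := hM.pearson_expand (P n) (P n)
    rw [h.map_X_mul (h.degree_comp_lt _ (by omega)), h.map_X_mul (h.degree_comp_lt _ (by omega)),
      h.map_X_mul (h.degree_X_mul_comp q n), h.map_mul (h.degree_comp_lt _ (by omega)),
      h.coeff_X_mul_comp hq0.ne', coeff_X_mul] at e
    simp only [comp_C_mul_X_coeff, h.coeff_self, h.coeff_of_lt (Nat.lt_succ_self n)] at e
    rw [diagRatio, h.map_self]
    rw [inv_pow, pow_zero] at e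
    have hQ : q ^ n ≠ 0 := (pow_pos hq0 n).ne'
    generalize q ^ n = Q at *
    field_simp at e ⊢
    linear_combination e
  · rcases n with _ | n
    · simp [normRatio, offdiagRatio, h.subleading_zero]
    · have h0 := (hpos n).ne'
      have e := hM.pearson_expand (P (n + 1)) (P n)
      rw [h.map_X_mul (h.degree_comp_lt _ (by omega)), h.map_X_mul (h.degree_comp_lt _ (by omega)),
        h.map_X_mul (n := n + 1)
          ((h.degree_X_mul_comp q n).trans (by exact_mod_cast Nat.lt_succ_self _)),
        h.map_mul (h.degree_comp_lt _ (by omega)), coeff_X_mul, coeff_X_mul] at e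
      simp only [comp_C_mul_X_coeff, h.coeff_self, h.coeff_succ,
        h.coeff_of_lt (Nat.lt_succ_self n),
        h.coeff_of_lt (show n < n + 1 + 1 by omega)] at e
      have e' := h.map_mul_succ n
      rw [mul_comm (P n)] at e'
      rw [normRatio, offdiagRatio, e']
      simp only [inv_pow, pow_zero, pow_succ q n, zero_mul, sub_zero] at e
      rw [pow_succ q n]
      have hQ : q ^ n ≠ 0 := (pow_pos hq0 n).ne'
      generalize q ^ n = Q at *
      field_simp at e ⊢
      apply mul_left_cancel₀ hq.ne'
      linear_combination -e
  · have h0 := (hpos n).ne'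
    have key : M (X * (P n * P n)) = M (P (n + 1) * P n) +
        offdiagRatio M P n * M (X * (P n * P n)) +
        (subleading P n - subleading P (n + 1)) * M (P n * P n) := by
      rcases n with _ | n
      · have e : X * (P 0 * P 0) = P 1 * P 0 + (subleading P 0 - subleading P 1) • (P 0 * P 0) := by
          rw [← mul_assoc, h.three_term_zero hM.pos_X, smul_eq_C_mul]; ring
        conv_lhs => rw [e]
        simp [offdiagRatio]
      · have h0' := (hpos n).ne'
        have e : X * (P (n + 1) * P (n + 1)) = P (n + 2) * P (n + 1)
            + (subleading P (n + 1) - subleading P (n + 2)) • (P (n + 1) * P (n + 1))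
            + (M (X * (P (n + 1) * P (n + 1))) / M (X * (P n * P n))) • (P (n + 1) * P n) := by
          conv_lhs => rw [← mul_assoc, h.three_term hM.pos_X]
          rw [smul_eq_C_mul, smul_eq_C_mul]; ring
        conv_lhs => rw [e]
        rw [map_add, map_add, map_smul, map_smul, offdiagRatio, smul_eq_mul, smul_eq_mul]
        field_simp
        ring
    rw [offdiagRatio, diagRatio]
    field_simp
    linear_combination -key
  · have h0 := (hpos n).ne'
    have h1 := (hpos (n + 1)).ne'
    have e := h.map_mul_succ n
    rw [mul_comm (P n), h.map_succ_mul] at e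
    simp only [normRatio, diagRatio, offdiagRatio]
    rw [h.map_self, h.map_self, h.map_succ_mul]
    field_simp
    linear_combination (P n).coeff 0 * M (P (n + 1)) * -e

end IsQLaguerreFunctional

/-! ### The infinite product and the weight -/

section Weight

variable {q : ℝ}

theorem tendsto_qPochhammerInf (hq0 : 0 < q) (hq1 : q < 1) (a : ℝ) :
    Filter.Tendsto (fun n => ∏ j ∈ Finset.range n, (1 - a * q ^ j)) Filter.atTop
      (nhds (qPochhammerInf a q)) := by
  have hs : Summable fun j : ℕ => ‖-(a * q ^ j)‖ := by
    simpa using ((summable_geometric_of_lt_one hq0.le hq1).mul_left a).norm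
  have := (multipliable_one_add_of_summable hs).tendsto_prod_tprod_nat
  simp only [← sub_eq_add_neg] at this
  exact this

theorem qPochhammerInf_eq_mul (hq0 : 0 < q) (hq1 : q < 1) (a : ℝ) :
    qPochhammerInf a q = (1 - a) * qPochhammerInf (a * q) q := by
  refine tendsto_nhds_unique
    ((tendsto_qPochhammerInf hq0 hq1 a).comp (Filter.tendsto_add_atTop_nat 1)) ?_
  refine ((tendsto_qPochhammerInf hq0 hq1 (a * q)).const_mul (1 - a)).congr fun n => ?_
  simp only [Function.comp_apply, Finset.prod_range_succ', pow_zero, mul_one]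
  rw [mul_comm]
  congr 1
  exact Finset.prod_congr rfl fun j _ => by ring

theorem measurable_qPochhammerInf (hq0 : 0 < q) (hq1 : q < 1) :
    Measurable fun a => qPochhammerInf a q := by
  refine measurable_of_tendsto_metrizable
    (f := fun n a => ∏ j ∈ Finset.range n, (1 - a * q ^ j)) (fun n => ?_)
    (tendsto_pi_nhds.2 fun a => tendsto_qPochhammerInf hq0 hq1 a)
  fun_prop

theorem prod_le_qPochhammerInf (hq0 : 0 < q) (hq1 : q < 1) {y : ℝ} (hy : 0 ≤ y) (N : ℕ) :
    ∏ j ∈ Finset.range N, (1 + y * q ^ j) ≤ qPochhammerInf (-y) q := by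
  refine ge_of_tendsto (tendsto_qPochhammerInf hq0 hq1 (-y)) ?_
  filter_upwards [Filter.eventually_ge_atTop N] with n hn
  simp only [neg_mul, sub_neg_eq_add]
  refine Finset.prod_le_prod_of_subset_of_one_le (Finset.range_mono hn)
    (fun j _ => by positivity) fun j _ _ => ?_
  have : 0 ≤ y * q ^ j := by positivity
  linarith

theorem one_le_qPochhammerInf (hq0 : 0 < q) (hq1 : q < 1) {y : ℝ} (hy : 0 ≤ y) :
    1 ≤ qPochhammerInf (-y) q := by
  simpa using prod_le_qPochhammerInf hq0 hq1 hy 0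

theorem le_qPochhammerInf (hq0 : 0 < q) (hq1 : q < 1) {y : ℝ} (hy : 0 ≤ y) :
    y ≤ qPochhammerInf (-y) q := by
  have := prod_le_qPochhammerInf hq0 hq1 hy 1
  simp at this
  linarith

theorem pow_le_qPochhammerInf (hq0 : 0 < q) (hq1 : q < 1) {y : ℝ} (hy : 0 ≤ y) (N : ℕ) :
    (y * q ^ N) ^ N ≤ qPochhammerInf (-y) q := by
  have h : ∏ _j ∈ Finset.range N, y * q ^ N ≤ ∏ j ∈ Finset.range N, (1 + y * q ^ j) := by
    refine Finset.prod_le_prod (fun _ _ => by positivity) fun j hj => ?_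
    have : q ^ N ≤ q ^ j := pow_le_pow_of_le_one hq0.le hq1.le (Finset.mem_range.1 hj).le
    nlinarith
  rw [Finset.prod_const, Finset.card_range] at h
  exact h.trans (prod_le_qPochhammerInf hq0 hq1 hy N)

variable {α t : ℝ}

theorem measurable_weight (hq0 : 0 < q) (hq1 : q < 1) : Measurable (weight q α t) := by
  have h := measurable_qPochhammerInf hq0 hq1
  unfold weight
  refine (measurable_id.pow_const α).div ((h.comp ?_).mul (h.comp ?_)) <;> fun_prop

theorem weight_pos (hq0 : 0 < q) (hq1 : q < 1) (ht : 0 < t) {x : ℝ} (hx : 0 < x) :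
    0 < weight q α t x := by
  have hq : 0 < 1 - q := by linarith
  have h1 := one_le_qPochhammerInf hq0 hq1 (y := (1 - q) * x) (by positivity)
  have h2 := one_le_qPochhammerInf hq0 hq1 (y := (1 - q) * (t / x)) (by positivity)
  rw [weight, neg_mul, neg_mul]
  exact div_pos (Real.rpow_pos_of_pos hx α) (by nlinarith)

/-- The Pearson equation of the weight. -/
theorem weight_mul (hq0 : 0 < q) (hq1 : q < 1) (ht : 0 < t) {x : ℝ} (hx : 0 < x) :
    (q * x + (1 - q) * t) * weight q α t (q * x) =
      q * q ^ α * (x * (1 + (1 - q) * x)) * weight q α t x := by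
  have hq : 0 < 1 - q := by linarith
  have h1 := one_le_qPochhammerInf hq0 hq1 (y := (1 - q) * (q * x)) (by positivity)
  have h2 := one_le_qPochhammerInf hq0 hq1 (y := (1 - q) * (t / x)) (by positivity)
  have e1 := qPochhammerInf_eq_mul hq0 hq1 (-((1 - q) * x))
  have e2 := qPochhammerInf_eq_mul hq0 hq1 (-((1 - q) * (t / (q * x))))
  rw [show -((1 - q) * x) * q = -((1 - q) * (q * x)) by ring] at e1
  rw [show -((1 - q) * (t / (q * x))) * q = -((1 - q) * (t / x)) by field_simp] at e2
  simp only [weight, neg_mul]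
  rw [e1, e2, Real.mul_rpow hq0.le hx.le]
  have p1 : 0 < 1 - -((1 - q) * x) := by nlinarith
  have p2 : 0 < 1 - -((1 - q) * (t / (q * x))) := by
    have : 0 < (1 - q) * (t / (q * x)) := by positivity
    linarith
  have p3 : qPochhammerInf (-((1 - q) * (q * x))) q ≠ 0 := by linarith
  have p4 : qPochhammerInf (-((1 - q) * (t / x))) q ≠ 0 := by linarith
  have p2' : 1 - -((1 - q) * (t / (q * x))) = (q * x + (1 - q) * t) / (q * x) := by
    field_simp; ring
  have p5 : 0 < q * x + (1 - q) * t := by positivity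
  rw [p2', sub_neg_eq_add] at *
  generalize qPochhammerInf (-((1 - q) * (q * x))) q = A at *
  generalize qPochhammerInf (-((1 - q) * (t / x))) q = B at *
  field_simp

/-- A single factor of the second infinite product compensates the division by `x` near `0`. -/
theorem weight_le_near_zero (hq0 : 0 < q) (hq1 : q < 1) (ht : 0 < t) {x : ℝ} (hx : 0 < x) :
    weight q α t x / x ≤ ((1 - q) * t)⁻¹ * x ^ α := by
  have hq : 0 < 1 - q := by linarith
  have h1 := one_le_qPochhammerInf hq0 hq1 (y := (1 - q) * x) (by positivity)
  have h2 := le_qPochhammerInf hq0 hq1 (y := (1 - q) * (t / x)) (by positivity)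
  rw [weight, neg_mul, neg_mul, div_div, inv_mul_eq_div]
  refine div_le_div_of_nonneg_left (by positivity) (by positivity) ?_
  calc (1 - q) * t = 1 * ((1 - q) * (t / x)) * x := by field_simp
    _ ≤ _ := by gcongr

/-- Finitely many factors of the first infinite product beat any power of `x`. -/
theorem weight_le_at_top (hq0 : 0 < q) (hq1 : q < 1) (ht : 0 < t) (N : ℕ) {x : ℝ} (hx : 0 < x) :
    weight q α t x / x ≤ (((1 - q) * q ^ N) ^ N)⁻¹ * x ^ (α - 1 - N) := by
  have hq : 0 < 1 - q := by linarith
  have h1 := pow_le_qPochhammerInf hq0 hq1 (y := (1 - q) * x) (by positivity) N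
  have h2 := one_le_qPochhammerInf hq0 hq1 (y := (1 - q) * (t / x)) (by positivity)
  have h3 := zero_le_one.trans
    (one_le_qPochhammerInf hq0 hq1 (y := (1 - q) * x) (by positivity))
  rw [weight, neg_mul, neg_mul, div_div, inv_mul_eq_div, Real.rpow_sub hx, Real.rpow_sub hx,
    Real.rpow_one, Real.rpow_natCast, div_div, div_div]
  refine div_le_div_of_nonneg_left (by positivity) (by positivity) ?_
  calc x * (x ^ N * ((1 - q) * q ^ N) ^ N) = ((1 - q) * x * q ^ N) ^ N * 1 * x := by
        rw [mul_right_comm (1 - q) x, mul_pow _ x]; ring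
    _ ≤ _ := by gcongr

theorem integrableOn_pow_mul_weight (hq0 : 0 < q) (hq1 : q < 1) (hα : -1 < α) (ht : 0 < t)
    (k : ℕ) : IntegrableOn (fun x => x ^ k * (weight q α t x / x)) (Set.Ioi 0) := by
  have hm : Measurable fun x => x ^ k * (weight q α t x / x) :=
    (measurable_id.pow_const k).mul ((measurable_weight hq0 hq1).div measurable_id)
  have hq : 0 < 1 - q := by linarith
  rw [← Set.Ioc_union_Ioi_eq_Ioi zero_le_one]
  refine IntegrableOn.union ?_ ?_
  · rw [integrableOn_Ioc_iff_integrableOn_Ioo]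
    refine Integrable.mono'
      (((intervalIntegral.integrableOn_Ioo_rpow_iff one_pos).2 hα).const_mul ((1 - q) * t)⁻¹)
      hm.aestronglyMeasurable ?_
    filter_upwards [ae_restrict_mem measurableSet_Ioo] with x hx
    have hw := weight_pos (α := α) hq0 hq1 ht hx.1
    have hx0 := hx.1
    rw [Real.norm_of_nonneg (by positivity)]
    calc x ^ k * (weight q α t x / x) ≤ 1 * (weight q α t x / x) := by
          gcongr; exact pow_le_one₀ hx.1.le hx.2.le
      _ ≤ _ := by rw [one_mul]; exact weight_le_near_zero hq0 hq1 ht hx.1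
  · obtain ⟨N, hN⟩ := exists_nat_gt (k + α)
    refine Integrable.mono'
      ((integrableOn_Ioi_rpow_of_lt (a := k + (α - 1 - N)) (by linarith) one_pos).const_mul
        (((1 - q) * q ^ N) ^ N)⁻¹) hm.aestronglyMeasurable ?_
    filter_upwards [ae_restrict_mem measurableSet_Ioi] with x hx
    have hx0 : 0 < x := one_pos.trans hx
    have hw := weight_pos (α := α) hq0 hq1 ht hx0
    rw [Real.norm_of_nonneg (by positivity), Real.rpow_add hx0, Real.rpow_natCast,
      mul_left_comm]
    gcongr
    exact weight_le_at_top hq0 hq1 ht N hx0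

/-- All moments of order at least `-1` of the weight converge. -/
theorem integrableOn_eval_mul_weight (hq0 : 0 < q) (hq1 : q < 1) (hα : -1 < α) (ht : 0 < t)
    (f : ℝ[X]) : IntegrableOn (fun x => f.eval x * (weight q α t x / x)) (Set.Ioi 0) := by
  induction f using Polynomial.induction_on' with
  | add f g hf hg => simp only [eval_add, add_mul]; exact hf.add hg
  | monomial n a =>
    simp only [eval_monomial, mul_assoc]
    exact (integrableOn_pow_mul_weight hq0 hq1 hα ht n).const_mul a

/-- The functional `f ↦ ∫ f(x) w(x) / x dx` over `x > 0`. -/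
noncomputable def momentFunctional (q α t : ℝ) (hq0 : 0 < q) (hq1 : q < 1) (hα : -1 < α)
    (ht : 0 < t) : ℝ[X] →ₗ[ℝ] ℝ where
  toFun f := ∫ x in Set.Ioi (0 : ℝ), f.eval x * (weight q α t x / x)
  map_add' f g := by
    simp only [eval_add, add_mul]
    exact integral_add (integrableOn_eval_mul_weight hq0 hq1 hα ht f)
      (integrableOn_eval_mul_weight hq0 hq1 hα ht g)
  map_smul' c f := by
    simp only [eval_smul, smul_eq_mul, mul_assoc, RingHom.id_apply]
    exact integral_const_mul _ _

theorem momentFunctional_pos (hq0 : 0 < q) (hq1 : q < 1) (hα : -1 < α) (ht : 0 < t) {f : ℝ[X]}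
    (hf : f ≠ 0) (hf0 : ∀ x > 0, 0 ≤ f.eval x) :
    0 < momentFunctional q α t hq0 hq1 hα ht f := by
  change 0 < ∫ x in Set.Ioi (0 : ℝ), f.eval x * (weight q α t x / x)
  rw [setIntegral_pos_iff_support_of_nonneg_ae ?_ (integrableOn_eval_mul_weight hq0 hq1 hα ht f)]
  · have hsub : Set.Ioi (0 : ℝ) \ {x | f.IsRoot x} ⊆
        Function.support (fun x => f.eval x * (weight q α t x / x)) ∩ Set.Ioi 0 := by
      intro x hx
      exact ⟨mul_ne_zero hx.2 (div_pos (weight_pos hq0 hq1 ht hx.1) hx.1).ne', hx.1⟩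
    refine lt_of_lt_of_le ?_ (measure_mono hsub)
    rw [measure_sdiff_null ((finite_setOfPred_isRoot hf).measure_zero _)]
    simp
  · filter_upwards [ae_restrict_mem measurableSet_Ioi] with x hx
    exact mul_nonneg (hf0 x hx) (div_pos (weight_pos hq0 hq1 ht hx) hx).le

/-- Substitute `x ↦ q x` in the integral and use the Pearson equation `weight_mul`. -/
theorem momentFunctional_pearson (hq0 : 0 < q) (hq1 : q < 1) (hα : -1 < α) (ht : 0 < t)
    (f g : ℝ[X]) :
    momentFunctional q α t hq0 hq1 hα ht ((X + C ((1 - q) * t)) * (f.comp (C q⁻¹ * X) * g)) =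
      q * q ^ α * momentFunctional q α t hq0 hq1 hα ht
        (X * (1 + C (1 - q) * X) * (f * g.comp (C q * X))) := by
  change ∫ x in Set.Ioi (0 : ℝ), _ = _ * ∫ x in Set.Ioi (0 : ℝ), _
  have h := integral_comp_mul_left_Ioi (fun x =>
    ((X + C ((1 - q) * t)) * (f.comp (C q⁻¹ * X) * g)).eval x * (weight q α t x / x)) 0 hq0
  rw [mul_zero, smul_eq_mul, eq_inv_mul_iff_mul_eq₀ hq0.ne'] at h
  rw [← h, ← integral_const_mul, ← integral_const_mul]
  refine setIntegral_congr_fun measurableSet_Ioi fun x hx => ?_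
  have hx0 : 0 < x := hx
  have hw := weight_mul (α := α) hq0 hq1 ht hx0
  simp only [eval_mul, eval_add, eval_comp, eval_X, eval_C, eval_one,
    inv_mul_cancel_left₀ hq0.ne']
  field_simp
  linear_combination f.eval x * g.eval (q * x) * hw

end Weight

/-! ### The difference equation -/

theorem isQLaguerreFunctional_momentFunctional {q α t : ℝ} (hq0 : 0 < q) (hq1 : q < 1)
    (hα : -1 < α) (ht : 0 < t) :
    IsQLaguerreFunctional q (q ^ α) t (momentFunctional q α t hq0 hq1 hα ht) where
  pos f hf := momentFunctional_pos hq0 hq1 hα ht (mul_ne_zero hf hf) fun x _ => by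
    rw [eval_mul]; exact mul_self_nonneg _
  pos_X f hf := momentFunctional_pos hq0 hq1 hα ht (mul_ne_zero X_ne_zero (mul_ne_zero hf hf))
    fun x hx => by
      rw [eval_mul, eval_mul, eval_X]
      exact mul_nonneg (le_of_lt hx) (mul_self_nonneg _)
  pearson := momentFunctional_pearson hq0 hq1 hα ht

theorem IsMonicOrthogonal.isMonicOrthogonalFor {q α t : ℝ} (hq0 : 0 < q) (hq1 : q < 1)
    (hα : -1 < α) (ht : 0 < t) {P : ℕ → ℝ[X]} (hP : IsMonicOrthogonal (weight q α t) P) :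
    IsMonicOrthogonalFor (momentFunctional q α t hq0 hq1 hα ht) P where
  monic := hP.monic
  natDegree_eq := hP.natDegree_eq
  orthogonal m n hmn := by
    rw [← hP.orthogonal m n hmn]
    refine setIntegral_congr_fun measurableSet_Ioi fun x hx => ?_
    have hx0 : x ≠ 0 := ne_of_gt hx
    simp only [eval_mul, eval_X]
    field_simp

/-- `J n` is a positive multiple of `∫ P_n² w / x`; hence `J n > 0`. -/
theorem J_eq_diagRatio {q α t T : ℝ} {ϱ p β R S : ℕ → ℝ}
    (h : LadderRelations q (q ^ α) t p β R S) (hq0 : 0 < q) (hq1 : q < 1) (ht : 0 < t)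
    (hT : T = (1 - q) ^ 2 / q * t) (hϱ : ∀ k, ϱ k = (1 - q) ^ 2 / q * p k) (n : ℕ) :
    J q α T ϱ n = S n / (q ^ n * q ^ α * (1 - q)) := by
  have hq : 1 - q ≠ 0 := by linarith
  have hb : q ^ α ≠ 0 := (Real.rpow_pos_of_pos hq0 α).ne'
  have hQ : q ^ n ≠ 0 := (pow_pos hq0 n).ne'
  have h1 := h.diag n
  have e : q ^ (-2 * (n : ℝ) - α - 1) = ((q ^ n) ^ 2 * q ^ α * q)⁻¹ := by
    rw [show -2 * (n : ℝ) - α - 1 = -((n : ℝ) + n + α + 1) by ring, Real.rpow_neg hq0.le,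
      Real.rpow_add_one hq0.ne', Real.rpow_add hq0, Real.rpow_add hq0, Real.rpow_natCast, sq]
  rw [J, e, hT, hϱ, hϱ]
  generalize q ^ n = Q at *
  generalize q ^ α = b at *
  field_simp
  linear_combination -h1

end QLaguerre

open QLaguerre in
theorem mainTheorem5 (q α t : ℝ) (hq0 : 0 < q) (hq1 : q < 1) (hα : -1 < α) (ht : 0 < t)
    (P : ℕ → Polynomial ℝ)
    (hP : QLaguerre.IsMonicOrthogonal (QLaguerre.weight q α t) P)
    (T : ℝ) (hT : T = QLaguerre.paramT q t)
    (ϱ : ℕ → ℝ) (hϱ : ∀ k, ϱ k = QLaguerre.rho q P k)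
    (n : ℕ) (hn : 1 ≤ n) :
    QLaguerre.J q α T ϱ n + QLaguerre.J q α T ϱ (n - 1) ≠ 0 ∧
    QLaguerre.differencePolynomial q α T ϱ n = 0 ∧
    QLaguerre.G q α T ϱ n ^ 2
      - QLaguerre.H q α T ϱ n * (2 * QLaguerre.G q α T ϱ n - QLaguerre.F q α T ϱ n ^ 2)
      + QLaguerre.I q α T ϱ n * QLaguerre.F q α T ϱ n * QLaguerre.G q α T ϱ n
      + QLaguerre.I q α T ϱ n * QLaguerre.H q α T ϱ n * QLaguerre.F q α T ϱ n
      + QLaguerre.I q α T ϱ n ^ 2 * QLaguerre.G q α T ϱ n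
      + QLaguerre.H q α T ϱ n ^ 2 = 0 := by
  obtain ⟨m, rfl⟩ : ∃ m, n = m + 1 := ⟨n - 1, by omega⟩
  have h := (isQLaguerreFunctional_momentFunctional hq0 hq1 hα ht).ladderRelations
    (hP.isMonicOrthogonalFor hq0 hq1 hα ht) hq0 hq1
  have hJ := J_eq_diagRatio h hq0 hq1 ht hT hϱ
  have e1 : q ^ (((m + 1 : ℕ) : ℝ) + α) = q ^ (m + 1) * q ^ α := by
    rw [Real.rpow_add hq0, Real.rpow_natCast]
  have e2 : q ^ (2 * ((m + 1 : ℕ) : ℝ) + α) = (q ^ (m + 1)) ^ 2 * q ^ α := by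
    rw [two_mul, Real.rpow_add hq0, Real.rpow_add hq0, Real.rpow_natCast, sq]
  obtain ⟨hne, hres⟩ := h.difference_equation hq0 hq1 (Real.rpow_pos_of_pos hq0 α) m
    (F := F q α T ϱ (m + 1)) (G := G q α T ϱ (m + 1)) (H := H q α T ϱ (m + 1))
    (I := I q α T ϱ (m + 1)) rfl (hJ (m + 1)) (hJ m) hT (hϱ (m + 1))
    (by rw [F, e2]) (by rw [G, e1, e2]) (by rw [H, e1]; rfl) (by rw [I, e2]; rfl)
  refine ⟨hne, ?_, hres⟩
  -- Multiplying by `(J_n + J_{n-1})²` clears the denominators of `H` and `I`.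
  rw [← mul_zero ((J q α T ϱ (m + 1) + J q α T ϱ m) ^ 2), ← hres]
  rw [differencePolynomial, H, I]
  simp only [Nat.add_sub_cancel]
  generalize F q α T ϱ (m + 1) = F₁
  generalize G q α T ϱ (m + 1) = G₁
  generalize J q α T ϱ (m + 1) = J₁ at *
  generalize J q α T ϱ m = J₀ at *
  field_simp
  ring
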